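/- For a finite group $G$ let $\mathcal U_G$ be the category whose objects are the finite $G$-sets and whose morphisms $X\to Y$ are the equivalence classes of diagrams of finite $G$-sets $X\xleftarrow{w}A\xrightarrow{v}B\xrightarrow{u}Y$, where $(w,v,u)$ and $(w',v',u')$ are equivalent if there are isomorphisms $a\colon A\to A'$, $b\colon B\to B'$ with $u=u'b$, $bv=v'a$, $w=w'a$. The composite of $[X\leftarrow A\to B\to Y]$ followed by $[Y\leftarrow C\xrightarrow{q}D\to Z]$ is $[X\leftarrow A''\to\widetilde D\to Z]$, where $B'=B\times_YC$, $A'=A\times_BB'$, $$\widetilde D=\Pi_q(B')=\{(d,\sigma)\mid d\in D,\ \sigma\colon q^{-1}(d)\to B'\text{ a map of sets that is a section over } q^{-1}(d) \text{ of the projection } B'\to C\}$$ with $G$-action $g(d,\sigma)=(gd,\,c\mapsto g\,\sigma(g^{-1}c))$, $\widetilde C=C\times_D\widetilde D$ with the evaluation map $\widetilde C\to B'$, $(c,(d,\sigma))\mapsto\sigma(c)$, and $A''=A'\times_{B'}\widetilde C$. For a category $\mathcal C$ with finite products, $\mathrm{Add}(\mathcal C,\mathrm{Set})$ denotes the full subcategory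 of the category of functors $\mathcal C\to\mathrm{Set}$ on those that preserve finite products. Let $G,H$ be finite groups and let $F\colon\mathcal U_G\to\mathcal U_H$ be a functor that preserves finite products. Then the functor $$-\circ F\colon \mathrm{Add}(\mathcal U_H,\mathrm{Set})\to\mathrm{Add}(\mathcal U_G,\mathrm{Set})$$ has a left adjoint $L_F$. Moreover, for every $\mathcal T\in\mathrm{Add}(\mathcal U_G,\mathrm{Set})$ the functor $L_F\mathcal T$, together with the component $\mathcal T\to (L_F\mathcal T)\circ F$ of the unit of the adjunction, is a pointwise left Kan extension of $\mathcal T$ along $F$. -/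

import Mathlib

open CategoryTheory

universe u

/-- The category of finite `G`-sets: objects of `FintypeCat` with a `G`-action, and
equivariant maps. -/
abbrev FinGSet (G : Type u) [Group G] := Action FintypeCat.{u} G

namespace FinGSet

variable {G : Type u} [Group G]

/-- The finite `G`-set given by a finite type with a `G`-action. -/
abbrev of (G : Type u) [Group G] (T : Type u) [Finite T] [MulAction G T] : FinGSet G :=
  Action.FintypeCat.ofMulAction G (FintypeCat.of T)

/-- Equivariance of a morphism of `G`-sets, elementwise. -/
theorem hom_smul {X Y : FinGSet G} (f : X ⟶ Y) (g : G) (x : X.V) :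
    f.hom (g • x) = g • f.hom x :=
  ConcreteCategory.congr_hom (f.comm g) x

/-- The morphism of `G`-sets given by an equivariant map. -/
def homMk {X Y : FinGSet G} (f : X.V → Y.V) (hf : ∀ (g : G) (x : X.V), f (g • x) = g • f x) :
    X ⟶ Y where
  hom := FintypeCat.homMk f
  comm g := by
    ext x
    exact hf g x

/-- The isomorphism of `G`-sets given by an equivariant bijection. -/
def isoMk {X Y : FinGSet G} (e : X.V ≃ Y.V) (he : ∀ (g : G) (x : X.V), e (g • x) = g • e x) :
    X ≅ Y where
  hom := homMk e he
  inv := homMk e.symm fun g y => by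
    rw [Equiv.symm_apply_eq, he, Equiv.apply_symm_apply]
  hom_inv_id := by
    ext x
    exact e.symm_apply_apply x
  inv_hom_id := by
    ext x
    exact e.apply_symm_apply x

/-- The underlying set of the fibre product `X ×_Z Y`. -/
def PullbackSet {X Y Z : FinGSet G} (f : X ⟶ Z) (g : Y ⟶ Z) : Type u :=
  {p : X.V × Y.V // f.hom p.1 = g.hom p.2}

instance {X Y Z : FinGSet G} (f : X ⟶ Z) (g : Y ⟶ Z) : Finite (PullbackSet f g) :=
  inferInstanceAs (Finite {p : X.V × Y.V // f.hom p.1 = g.hom p.2})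

instance {X Y Z : FinGSet G} (f : X ⟶ Z) (g : Y ⟶ Z) : MulAction G (PullbackSet f g) where
  smul a p := ⟨(a • p.1.1, a • p.1.2), by
    have := p.2
    simp only [hom_smul, this]⟩
  one_smul p := Subtype.ext (Prod.ext (one_smul G p.1.1) (one_smul G p.1.2))
  mul_smul a b p := Subtype.ext (Prod.ext (mul_smul a b p.1.1) (mul_smul a b p.1.2))

/-- The fibre product of finite `G`-sets, with the diagonal action. -/
def pullback {X Y Z : FinGSet G} (f : X ⟶ Z) (g : Y ⟶ Z) : FinGSet G :=
  of G (PullbackSet f g)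

/-- The first projection of a fibre product. -/
def pullbackFst {X Y Z : FinGSet G} (f : X ⟶ Z) (g : Y ⟶ Z) : pullback f g ⟶ X :=
  homMk (fun p : PullbackSet f g => p.1.1) fun _ _ => rfl

/-- The second projection of a fibre product. -/
def pullbackSnd {X Y Z : FinGSet G} (f : X ⟶ Z) (g : Y ⟶ Z) : pullback f g ⟶ Y :=
  homMk (fun p : PullbackSet f g => p.1.2) fun _ _ => rfl

/-- The underlying set of `Π_f(A)`: the pairs `(y, σ)` of a point `y` of `Y` and a map of sets
`σ : f⁻¹(y) → A` such that `p ∘ σ` is the inclusion of `f⁻¹(y)` in `X`. -/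
structure PiSet {A X Y : FinGSet G} (f : X ⟶ Y) (p : A ⟶ X) : Type u where
  /-- the point `y` -/
  base : Y.V
  /-- the section `σ` on the fibre over `y` -/
  sec : (x : X.V) → f.hom x = base → A.V
  /-- `p ∘ σ` is the inclusion -/
  proj_sec : ∀ (x : X.V) (hx : f.hom x = base), p.hom (sec x hx) = x

theorem PiSet.ext' {A X Y : FinGSet G} {f : X ⟶ Y} {p : A ⟶ X} {s t : PiSet f p}
    (hb : s.base = t.base) (hs : ∀ x h h', s.sec x h = t.sec x h') : s = t := by
  obtain ⟨y, σ, _⟩ := s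
  obtain ⟨y', σ', _⟩ := t
  obtain rfl : y = y' := hb
  obtain rfl : σ = σ' := funext fun x => funext fun h => hs x h h
  rfl

instance {A X Y : FinGSet G} (f : X ⟶ Y) (p : A ⟶ X) : Finite (PiSet f p) := by
  classical
  refine Finite.of_injective
    (β := Σ y : Y.V, ({x : X.V // f.hom x = y} → A.V)) (fun s => ⟨s.base, fun x => s.sec x x.2⟩) ?_
  rintro ⟨y, σ, _⟩ ⟨y', σ', _⟩ h
  obtain ⟨rfl, h⟩ := Sigma.mk.inj h
  refine PiSet.ext' rfl fun x hx _ => ?_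
  exact congrFun (eq_of_heq h) ⟨x, hx⟩

/-- The action `g (y, σ) = (g y, x ↦ g σ(g⁻¹ x))`. -/
instance {A X Y : FinGSet G} (f : X ⟶ Y) (p : A ⟶ X) : MulAction G (PiSet f p) where
  smul g s :=
    { base := g • s.base
      sec := fun x hx => g • s.sec (g⁻¹ • x) (by rw [hom_smul, hx, inv_smul_smul])
      proj_sec := fun x hx => by rw [hom_smul, s.proj_sec, smul_inv_smul] }
  one_smul s := by
    refine PiSet.ext' (one_smul G s.base) fun x h h' => ?_
    change (1 : G) • s.sec _ _ = _
    simp only [one_smul, inv_one]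
  mul_smul a b s := by
    refine PiSet.ext' (mul_smul a b s.base) fun x h h' => ?_
    change (a * b) • s.sec _ _ = a • b • s.sec _ _
    simp only [mul_smul, mul_inv_rev]

/-- The finite `G`-set `Π_f(A)`, for `f : X ⟶ Y` and `p : A ⟶ X`. -/
def pi {A X Y : FinGSet G} (f : X ⟶ Y) (p : A ⟶ X) : FinGSet G :=
  of G (PiSet f p)

/-- The map `π : Π_f(A) ⟶ Y`, `(y, σ) ↦ y`. -/
def piProj {A X Y : FinGSet G} (f : X ⟶ Y) (p : A ⟶ X) : pi f p ⟶ Y :=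
  homMk (fun s : PiSet f p => s.base) fun _ _ => rfl

/-- The evaluation map `e : X ×_Y Π_f(A) ⟶ A`, `(x, (y, σ)) ↦ σ(x)`. -/
def piEval {A X Y : FinGSet G} (f : X ⟶ Y) (p : A ⟶ X) : pullback f (piProj f p) ⟶ A :=
  homMk (fun z : PullbackSet f (piProj f p) => PiSet.sec z.1.2 z.1.1 z.2) fun g z => by
    change g • PiSet.sec z.1.2 (g⁻¹ • g • z.1.1) _ = g • PiSet.sec z.1.2 z.1.1 _
    simp only [inv_smul_smul]

end FinGSet

/-- A bispan `X ← A → B → Y` of finite `G`-sets. -/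
structure Bispan {G : Type u} [Group G] (X Y : FinGSet G) where
  /-- the left middle object -/
  A : FinGSet G
  /-- the right middle object -/
  B : FinGSet G
  /-- the map `w : A ⟶ X` -/
  w : A ⟶ X
  /-- the map `v : A ⟶ B` -/
  v : A ⟶ B
  /-- the map `u : B ⟶ Y` -/
  u : B ⟶ Y

namespace Bispan

open FinGSet

variable {G : Type u} [Group G] {X Y Z W : FinGSet G}

/-- Two bispans are equivalent if there are isomorphisms `a : A ≅ A'` and `b : B ≅ B'`
compatible with the three maps. -/
def Equivalent (P Q : Bispan X Y) : Prop :=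
  ∃ (a : P.A ≅ Q.A) (b : P.B ≅ Q.B),
    P.u = b.hom ≫ Q.u ∧ P.v ≫ b.hom = a.hom ≫ Q.v ∧ P.w = a.hom ≫ Q.w

/-- Equivalence of bispans is an equivalence relation. -/
theorem equivalent_equivalence : Equivalence (Equivalent (X := X) (Y := Y)) where
  refl P := ⟨Iso.refl _, Iso.refl _, by simp, by simp, by simp⟩
  symm := by
    rintro P Q ⟨a, b, h1, h2, h3⟩
    refine ⟨a.symm, b.symm, by simp [h1], ?_, by simp [h3]⟩
    rw [Iso.symm_hom, Iso.symm_hom, Iso.comp_inv_eq, Category.assoc, h2, Iso.inv_hom_id_assoc]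
  trans := by
    rintro P Q R ⟨a, b, h1, h2, h3⟩ ⟨a', b', h1', h2', h3'⟩
    refine ⟨a ≪≫ a', b ≪≫ b', by simp [h1, h1'], ?_, by simp [h3, h3']⟩
    rw [Iso.trans_hom, Iso.trans_hom, reassoc_of% h2, h2', Category.assoc]

/-- The setoid of equivalence of bispans. -/
instance setoid (X Y : FinGSet G) : Setoid (Bispan X Y) where
  r := Equivalent
  iseqv := equivalent_equivalence

/-- The identity bispan. -/
def id (X : FinGSet G) : Bispan X X :=
  ⟨X, X, 𝟙 X, 𝟙 X, 𝟙 X⟩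

/-- The composite of `P = (X ← A → B → Y)` followed by `Q = (Y ← C → D → Z)`. With the fibre
products `B₁ = B ×_Y C` and `A₁ = A ×_B B₁`, the canonical exponential diagram generated by
`C → D` and `B₁ → C` gives `D₂ = Π(B₁)`, `C₂ = C ×_D D₂` and the evaluation `C₂ → B₁`; with
`A₂ = A₁ ×_{B₁} C₂` the composite is `X ← A₂ → D₂ → Z`. -/
def comp (P : Bispan X Y) (Q : Bispan Y Z) : Bispan X Z where
  A := pullback (pullbackSnd P.v (pullbackFst P.u Q.w)) (piEval Q.v (pullbackSnd P.u Q.w))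
  B := pi Q.v (pullbackSnd P.u Q.w)
  w := pullbackFst _ _ ≫ pullbackFst P.v (pullbackFst P.u Q.w) ≫ P.w
  v := pullbackSnd _ _ ≫ pullbackSnd Q.v (piProj Q.v (pullbackSnd P.u Q.w))
  u := piProj Q.v (pullbackSnd P.u Q.w) ≫ Q.u

/-! ### An elementwise description of the composite -/

/-- A bijection criterion for equivalence of bispans. -/
theorem equiv_of_bij {P Q : Bispan X Y} (a : P.A.V ≃ Q.A.V) (b : P.B.V ≃ Q.B.V)
    (ha : ∀ (g : G) x, a (g • x) = g • a x) (hb : ∀ (g : G) x, b (g • x) = g • b x)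
    (hu : ∀ x, P.u.hom x = Q.u.hom (b x)) (hv : ∀ x, b (P.v.hom x) = Q.v.hom (a x))
    (hw : ∀ x, P.w.hom x = Q.w.hom (a x)) : P ≈ Q :=
  ⟨isoMk a ha, isoMk b hb, by ext x; exact hu x, by ext x; exact hv x, by ext x; exact hw x⟩

theorem bij_of_equiv {P Q : Bispan X Y} (h : P ≈ Q) :
    ∃ (a : P.A.V ≃ Q.A.V) (b : P.B.V ≃ Q.B.V),
    (∀ (g : G) x, a (g • x) = g • a x) ∧ (∀ (g : G) x, b (g • x) = g • b x) ∧
    (∀ x, P.u.hom x = Q.u.hom (b x)) ∧ (∀ x, b (P.v.hom x) = Q.v.hom (a x)) ∧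
    (∀ x, P.w.hom x = Q.w.hom (a x)) := by
  obtain ⟨a, b, h1, h2, h3⟩ := h
  refine ⟨⟨fun x => a.hom.hom x, fun x => a.inv.hom x,
      fun x => ConcreteCategory.congr_hom (congrArg Action.Hom.hom a.hom_inv_id) x,
      fun x => ConcreteCategory.congr_hom (congrArg Action.Hom.hom a.inv_hom_id) x⟩,
    ⟨fun x => b.hom.hom x, fun x => b.inv.hom x,
      fun x => ConcreteCategory.congr_hom (congrArg Action.Hom.hom b.hom_inv_id) x,
      fun x => ConcreteCategory.congr_hom (congrArg Action.Hom.hom b.inv_hom_id) x⟩,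
    fun g x => hom_smul _ g x, fun g x => hom_smul _ g x, ?_, ?_, ?_⟩
  · exact fun x => ConcreteCategory.congr_hom (congrArg Action.Hom.hom h1) x
  · exact fun x => ConcreteCategory.congr_hom (congrArg Action.Hom.hom h2) x
  · exact fun x => ConcreteCategory.congr_hom (congrArg Action.Hom.hom h3) x

/-- The right middle set of a composite, described by elements. -/
structure CompB (P : Bispan X Y) (Q : Bispan Y Z) : Type u where
  /-- the base point -/
  d : Q.B.V
  /-- the lift of the fibre -/
  s : (c : Q.A.V) → Q.v.hom c = d → P.B.V
  /-- compatibility -/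
  hs : ∀ c h, P.u.hom (s c h) = Q.w.hom c

/-- The left middle set of a composite, described by elements. -/
structure CompA (P : Bispan X Y) (Q : Bispan Y Z) : Type u where
  /-- the point of the first bispan -/
  a : P.A.V
  /-- the point of the second bispan -/
  c : Q.A.V
  /-- the image -/
  t : CompB P Q
  /-- compatibility -/
  hc : Q.v.hom c = t.d
  /-- compatibility -/
  ha : P.v.hom a = t.s c hc

theorem CompB.ext' {P : Bispan X Y} {Q : Bispan Y Z} {s t : CompB P Q} (hb : s.d = t.d)
    (hs : ∀ c h h', s.s c h = t.s c h') : s = t := by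
  obtain ⟨y, σ, _⟩ := s
  obtain ⟨y', σ', _⟩ := t
  obtain rfl : y = y' := hb
  obtain rfl : σ = σ' := funext fun x => funext fun h => hs x h h
  rfl

theorem CompB.s_congr {P : Bispan X Y} {Q : Bispan Y Z} {s t : CompB P Q} (hst : s = t)
    {c c' : Q.A.V} (hc : c = c') (h : Q.v.hom c = s.d) (h' : Q.v.hom c' = t.d) :
    s.s c h = t.s c' h' := by
  subst hst hc
  rfl

theorem CompA.ext' {P : Bispan X Y} {Q : Bispan Y Z} {s t : CompA P Q} (ha : s.a = t.a)
    (hc : s.c = t.c) (ht : s.t = t.t) : s = t := by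
  obtain ⟨_, _, _, _, _⟩ := s
  obtain ⟨_, _, _, _, _⟩ := t
  obtain rfl := ha
  obtain rfl := hc
  obtain rfl := ht
  rfl

instance (P : Bispan X Y) (Q : Bispan Y Z) : Finite (CompB P Q) := by
  refine Finite.of_injective
    (β := Σ y : Q.B.V, ({x : Q.A.V // Q.v.hom x = y} → P.B.V)) (fun s => ⟨s.d, fun x => s.s x x.2⟩) ?_
  rintro ⟨y, σ, _⟩ ⟨y', σ', _⟩ h
  obtain ⟨rfl, h⟩ := Sigma.mk.inj h
  refine CompB.ext' rfl fun x hx _ => ?_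
  exact congrFun (eq_of_heq h) ⟨x, hx⟩

instance (P : Bispan X Y) (Q : Bispan Y Z) : Finite (CompA P Q) := by
  refine Finite.of_injective (β := P.A.V × Q.A.V × CompB P Q) (fun s => ⟨s.a, s.c, s.t⟩) ?_
  intro s t h
  simp only [Prod.mk.injEq] at h
  exact CompA.ext' h.1 h.2.1 h.2.2

instance (P : Bispan X Y) (Q : Bispan Y Z) : MulAction G (CompB P Q) where
  smul g t :=
    { d := g • t.d
      s := fun c hc => g • t.s (g⁻¹ • c) (by rw [hom_smul, hc, inv_smul_smul])
      hs := fun c hc => by rw [hom_smul, t.hs, hom_smul, smul_inv_smul] }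
  one_smul s := by
    refine CompB.ext' (one_smul G s.d) fun x h h' => ?_
    change (1 : G) • s.s _ _ = _
    simp only [one_smul, inv_one]
  mul_smul a b s := by
    refine CompB.ext' (mul_smul a b s.d) fun x h h' => ?_
    change (a * b) • s.s _ _ = a • b • s.s _ _
    simp only [mul_smul, mul_inv_rev]

instance (P : Bispan X Y) (Q : Bispan Y Z) : MulAction G (CompA P Q) where
  smul g t :=
    { a := g • t.a
      c := g • t.c
      t := g • t.t
      hc := by rw [hom_smul, t.hc]; rfl
      ha := by
        rw [hom_smul, t.ha]
        change _ = g • t.t.s _ _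
        simp only [inv_smul_smul] }
  one_smul s := CompA.ext' (one_smul G s.a) (one_smul G s.c) (one_smul G s.t)
  mul_smul a b s := CompA.ext' (mul_smul a b s.a) (mul_smul a b s.c) (mul_smul a b s.t)

/-- The composite of two bispans, described by elements. -/
def compElt (P : Bispan X Y) (Q : Bispan Y Z) : Bispan X Z where
  A := of G (CompA P Q)
  B := of G (CompB P Q)
  w := homMk (fun t : CompA P Q => P.w.hom t.a) fun g t => hom_smul P.w g (CompA.a t)
  v := homMk (fun t : CompA P Q => t.t) fun _ _ => rfl
  u := homMk (fun t : CompB P Q => Q.u.hom t.d) fun g t => hom_smul Q.u g (CompB.d t)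

theorem compElt_equiv_of {P : Bispan X Y} {Q : Bispan Y Z} {R : Bispan X Z}
    (a : R.A.V ≃ CompA P Q) (b : R.B.V ≃ CompB P Q)
    (ha : ∀ (g : G) x, a (g • x) = g • a x) (hb : ∀ (g : G) x, b (g • x) = g • b x)
    (hu : ∀ x, R.u.hom x = Q.u.hom (b x).d) (hv : ∀ x, b (R.v.hom x) = (a x).t)
    (hw : ∀ x, R.w.hom x = P.w.hom (a x).a) : R ≈ compElt P Q :=
  equiv_of_bij (Q := compElt P Q) a b ha hb hu hv hw

/-- Comparison of the two descriptions on the right middle sets. -/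
def compBEquiv (P : Bispan X Y) (Q : Bispan Y Z) :
    PiSet Q.v (pullbackSnd P.u Q.w) ≃ CompB P Q where
  toFun t :=
    { d := t.base
      s := fun c h => (t.sec c h : PullbackSet P.u Q.w).1.1
      hs := fun c h =>
        (t.sec c h : PullbackSet P.u Q.w).2.trans (congrArg Q.w.hom (t.proj_sec c h)) }
  invFun t :=
    { base := t.d
      sec := fun c h => (⟨(t.s c h, c), t.hs c h⟩ : PullbackSet P.u Q.w)
      proj_sec := fun _ _ => rfl }
  left_inv t := PiSet.ext' rfl fun c h _ =>
    Subtype.ext (Prod.ext rfl (t.proj_sec c h).symm)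
  right_inv _ := rfl

/-- Comparison of the two descriptions on the left middle sets. -/
def compAEquiv (P : Bispan X Y) (Q : Bispan Y Z) :
    PullbackSet (pullbackSnd P.v (pullbackFst P.u Q.w)) (piEval Q.v (pullbackSnd P.u Q.w)) ≃
      CompA P Q where
  toFun z :=
    { a := (z.1.1 : PullbackSet P.v (pullbackFst P.u Q.w)).1.1
      c := (z.1.2 : PullbackSet Q.v (piProj Q.v (pullbackSnd P.u Q.w))).1.1
      t := compBEquiv P Q (z.1.2 : PullbackSet Q.v (piProj Q.v (pullbackSnd P.u Q.w))).1.2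
      hc := (z.1.2 : PullbackSet Q.v (piProj Q.v (pullbackSnd P.u Q.w))).2
      ha := (z.1.1 : PullbackSet P.v (pullbackFst P.u Q.w)).2.trans
        (congrArg (fun x : PullbackSet P.u Q.w => x.1.1) z.2) }
  invFun z :=
    ⟨((⟨(z.a, (⟨(z.t.s z.c z.hc, z.c), z.t.hs _ _⟩ : PullbackSet P.u Q.w)), z.ha⟩ :
        PullbackSet P.v (pullbackFst P.u Q.w)),
      (⟨(z.c, (compBEquiv P Q).symm z.t), z.hc⟩ :
        PullbackSet Q.v (piProj Q.v (pullbackSnd P.u Q.w)))), rfl⟩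
  left_inv z := by
    obtain ⟨⟨⟨⟨a, β⟩, h1⟩, ⟨⟨c, t⟩, h2⟩⟩, h3⟩ := z
    have h4 : (compBEquiv P Q).symm (compBEquiv P Q t) = t := (compBEquiv P Q).symm_apply_apply t
    refine Subtype.ext (Prod.ext (Subtype.ext (Prod.ext rfl ?_))
      (Subtype.ext (Prod.ext rfl h4)))
    have h5 : β = PiSet.sec t c h2 := h3
    have h6 : c = (β : PullbackSet P.u Q.w).1.2 := (PiSet.proj_sec t c h2).symm.trans
      (congrArg (fun x : PullbackSet P.u Q.w => x.1.2) h5.symm)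
    have h7 : (PiSet.sec t c h2 : PullbackSet P.u Q.w).1.1 = (β : PullbackSet P.u Q.w).1.1 :=
      congrArg (fun x : PullbackSet P.u Q.w => x.1.1) h5.symm
    exact Subtype.ext (Prod.ext h7 h6)
  right_inv _ := rfl

theorem comp_equiv_compElt (P : Bispan X Y) (Q : Bispan Y Z) : P.comp Q ≈ compElt P Q :=
  compElt_equiv_of (R := P.comp Q) (compAEquiv P Q) (compBEquiv P Q)
    (fun _ _ => rfl) (fun _ _ => rfl) (fun _ => rfl) (fun _ => rfl) (fun _ => rfl)

theorem compElt_congr {P P' : Bispan X Y} {Q Q' : Bispan Y Z} (hP : P ≈ P') (hQ : Q ≈ Q') :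
    compElt P Q ≈ compElt P' Q' := by
  obtain ⟨a, b, ha, hb, hu, hv, hw⟩ := bij_of_equiv hP
  obtain ⟨a', b', ha', hb', hu', hv', hw'⟩ := bij_of_equiv hQ
  let eB : CompB P Q ≃ CompB P' Q' :=
    { toFun := fun t =>
        { d := b' t.d
          s := fun c h => b (t.s (a'.symm c) (b'.injective (by rw [hv', a'.apply_symm_apply, h])))
          hs := fun c h => by rw [← hu, t.hs, hw', a'.apply_symm_apply] }
      invFun := fun t =>
        { d := b'.symm t.d
          s := fun c h => b.symm (t.s (a' c) (by rw [← hv', h, b'.apply_symm_apply]))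
          hs := fun c h => by rw [hu, b.apply_symm_apply, t.hs, ← hw'] }
      left_inv := fun t => CompB.ext' (b'.symm_apply_apply _) fun c h h' => by
        simp only [Equiv.symm_apply_apply]
      right_inv := fun t => CompB.ext' (b'.apply_symm_apply _) fun c h h' => by
        simp only [Equiv.apply_symm_apply] }
  have hB : ∀ (g : G) t, eB (g • t) = g • eB t := by
    intro g t
    refine CompB.ext' (hb' g t.d) fun c h h' => ?_
    change b (g • t.s _ _) = g • b (t.s _ _)
    rw [hb]
    refine congrArg (fun y => g • b y) (CompB.s_congr rfl ?_ _ _)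
    rw [Equiv.eq_symm_apply, ha', a'.apply_symm_apply]
  refine compElt_equiv_of (R := compElt P Q)
    (show CompA P Q ≃ CompA P' Q' from
    { toFun := fun z =>
        { a := a z.a
          c := a' z.c
          t := eB z.t
          hc := by rw [← hv', z.hc]; rfl
          ha := by
            rw [← hv, z.ha]
            change b (z.t.s _ _) = b (z.t.s _ _)
            simp only [Equiv.symm_apply_apply] }
      invFun := fun z =>
        { a := a.symm z.a
          c := a'.symm z.c
          t := eB.symm z.t
          hc := by
            change _ = b'.symm z.t.d
            rw [Equiv.eq_symm_apply, hv', a'.apply_symm_apply, z.hc]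
          ha := by
            change _ = b.symm (z.t.s _ _)
            rw [Equiv.eq_symm_apply, hv, a.apply_symm_apply, z.ha]
            simp only [Equiv.apply_symm_apply] }
      left_inv := fun z => CompA.ext' (a.symm_apply_apply _) (a'.symm_apply_apply _)
        (eB.symm_apply_apply _)
      right_inv := fun z => CompA.ext' (a.apply_symm_apply _) (a'.apply_symm_apply _)
        (eB.apply_symm_apply _) }) eB ?_ ?_ ?_ ?_ ?_
  · exact fun g t => CompA.ext' (ha g (CompA.a t)) (ha' g (CompA.c t)) (hB g (CompA.t t))
  · exact hB
  · exact fun t => hu' _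
  · exact fun t => rfl
  · exact fun t => hw _

theorem comp_congr {P P' : Bispan X Y} {Q Q' : Bispan Y Z} (hP : P ≈ P') (hQ : Q ≈ Q') :
    P.comp Q ≈ P'.comp Q' :=
  Setoid.trans (comp_equiv_compElt P Q)
    (Setoid.trans (compElt_congr hP hQ) (Setoid.symm (comp_equiv_compElt P' Q')))

theorem id_compElt (Q : Bispan X Y) : Q ≈ compElt (id X) Q := by
  let eB : Q.B.V ≃ CompB (id X) Q :=
    { toFun := fun d => { d := d, s := fun c _ => Q.w.hom c, hs := fun _ _ => rfl }
      invFun := fun t => t.d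
      left_inv := fun _ => rfl
      right_inv := fun t => CompB.ext' rfl fun c h h' => (t.hs c h').symm }
  refine compElt_equiv_of
    { toFun := fun c => { a := Q.w.hom c, c := c, t := eB (Q.v.hom c), hc := rfl, ha := rfl }
      invFun := fun z => z.c
      left_inv := fun _ => rfl
      right_inv := fun z => ?_ } eB ?_ ?_ ?_ ?_ ?_
  · refine CompA.ext' ?_ rfl ?_
    · exact (z.t.hs z.c z.hc).symm.trans z.ha.symm
    · exact (congrArg eB z.hc).trans (eB.apply_symm_apply z.t)
  · intro g c
    refine CompA.ext' (hom_smul Q.w g c) rfl (CompB.ext' (hom_smul Q.v g c) fun c h h' => ?_)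
    change Q.w.hom c = g • Q.w.hom (g⁻¹ • c)
    rw [hom_smul, smul_inv_smul]
  · intro g d
    refine CompB.ext' rfl fun c h h' => ?_
    change Q.w.hom c = g • Q.w.hom (g⁻¹ • c)
    rw [hom_smul, smul_inv_smul]
  · exact fun _ => rfl
  · exact fun _ => rfl
  · exact fun _ => rfl

theorem compElt_id (P : Bispan X Y) : P ≈ compElt P (id Y) := by
  let eB : P.B.V ≃ CompB P (id Y) :=
    { toFun := fun b => { d := P.u.hom b, s := fun _ _ => b, hs := fun _ h => h.symm }
      invFun := fun t => t.s t.d rfl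
      left_inv := fun _ => rfl
      right_inv := fun t => CompB.ext' (t.hs _ _) fun c h h' =>
        show t.s t.d rfl = t.s c h' from CompB.s_congr rfl h'.symm _ _ }
  refine compElt_equiv_of
    { toFun := fun a =>
        { a := a, c := P.u.hom (P.v.hom a), t := eB (P.v.hom a), hc := rfl, ha := rfl }
      invFun := fun z => z.a
      left_inv := fun _ => rfl
      right_inv := fun z => ?_ } eB ?_ ?_ ?_ ?_ ?_
  · refine CompA.ext' rfl ?_ ?_
    · exact (congrArg P.u.hom z.ha).trans (z.t.hs z.c z.hc)
    · refine (congrArg eB (z.ha.trans ?_)).trans (eB.apply_symm_apply z.t)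
      exact CompB.s_congr rfl z.hc _ _
  · intro g a
    refine CompA.ext' rfl ?_ (CompB.ext' ?_ fun c h h' => ?_)
    · exact (congrArg P.u.hom (hom_smul P.v g a)).trans (hom_smul P.u g _)
    · exact (congrArg P.u.hom (hom_smul P.v g a)).trans (hom_smul P.u g _)
    · exact hom_smul P.v g a
  · intro g b
    exact CompB.ext' (hom_smul P.u g b) fun c h h' => rfl
  · exact fun _ => rfl
  · exact fun _ => rfl
  · exact fun _ => rfl

theorem compElt_assoc (P : Bispan X Y) (Q : Bispan Y Z) (R : Bispan Z W) :
    compElt (compElt P Q) R ≈ compElt P (compElt Q R) := by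
  let dB (t : CompB (compElt P Q) R) : CompB Q R :=
    { d := t.d
      s := fun e h => (t.s e h : CompB P Q).d
      hs := fun e h => t.hs e h }
  have key (t : CompB (compElt P Q) R) (y : CompA Q R) (h : y.t = dB t) :
      ∃ h1 : R.v.hom y.c = t.d, Q.v.hom y.a = (t.s y.c h1 : CompB P Q).d := by
    have h1 : R.v.hom y.c = t.d := y.hc.trans (congrArg CompB.d h)
    exact ⟨h1, y.ha.trans (CompB.s_congr h rfl y.hc h1)⟩
  have key' (t : CompB P (compElt Q R)) (y : CompA Q R) (h : y.t = t.d) (h1 h2) :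
      t.s y h = t.s ({ a := y.a, c := y.c, t := t.d, hc := h1, ha := h2 } : CompA Q R) rfl := by
    obtain ⟨a, c, t', hc, ha⟩ := y
    obtain rfl : t' = t.d := h
    rfl
  let eB : CompB (compElt P Q) R ≃ CompB P (compElt Q R) :=
    { toFun := fun t =>
        { d := dB t
          s := fun (y : CompA Q R) h =>
            (t.s y.c (key t y h).choose : CompB P Q).s y.a (key t y h).choose_spec
          hs := fun (y : CompA Q R) h => CompB.hs (t.s y.c (key t y h).choose : CompB P Q) _ _ }
      invFun := fun t =>
        { d := (t.d : CompB Q R).d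
          s := fun e h =>
            ({ d := (t.d : CompB Q R).s e h
               s := fun c h' =>
                t.s ({ a := c, c := e, t := t.d, hc := h, ha := h' } : CompA Q R) rfl
               hs := fun c h' => t.hs _ _ } : CompB P Q)
          hs := fun e h => CompB.hs (t.d : CompB Q R) e h }
      left_inv := fun t => rfl
      right_inv := fun t => CompB.ext' rfl fun y h h' => (key' t y h' _ _).symm }
  have hB : ∀ (g : G) t, eB (g • t) = g • eB t := fun g t =>
    CompB.ext' rfl fun (y : CompA Q R) h h' => rfl
  refine compElt_equiv_of (R := compElt (compElt P Q) R)
    (show CompA (compElt P Q) R ≃ CompA P (compElt Q R) from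
    { toFun := fun z =>
        { a := (z.a : CompA P Q).a
          c :=
           ({ a := (z.a : CompA P Q).c
              c := z.c
              t := dB z.t
              hc := z.hc
              ha := (CompA.hc (z.a : CompA P Q)).trans (congrArg CompB.d z.ha) } : CompA Q R)
          t := eB z.t
          hc := rfl
          ha := (CompA.ha (z.a : CompA P Q)).trans (CompB.s_congr z.ha rfl _ _) }
      invFun := fun z =>
        { a :=
           ({ a := z.a
              c := (z.c : CompA Q R).a
              t := (eB.symm z.t).s (z.c : CompA Q R).c
                ((CompA.hc (z.c : CompA Q R)).trans (congrArg CompB.d z.hc))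
              hc := (CompA.ha (z.c : CompA Q R)).trans (CompB.s_congr z.hc rfl _ _)
              ha := z.ha.trans (key' z.t z.c z.hc _ _) } : CompA P Q)
          c := (z.c : CompA Q R).c
          t := eB.symm z.t
          hc := (CompA.hc (z.c : CompA Q R)).trans (congrArg CompB.d z.hc)
          ha := rfl }
      left_inv := fun z => CompA.ext' (CompA.ext' rfl rfl z.ha.symm) rfl rfl
      right_inv := fun z => CompA.ext' rfl (CompA.ext' rfl rfl z.hc.symm)
        (eB.apply_symm_apply z.t) }) eB ?_ ?_ ?_ ?_ ?_
  · exact fun g z => CompA.ext' rfl (CompA.ext' rfl rfl rfl) (hB g (CompA.t z))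
  · exact hB
  · exact fun _ => rfl
  · exact fun _ => rfl
  · exact fun _ => rfl

theorem id_comp (Q : Bispan X Y) : (id X).comp Q ≈ Q :=
  Setoid.trans (comp_equiv_compElt _ _) (Setoid.symm (id_compElt Q))

theorem comp_id (P : Bispan X Y) : P.comp (id Y) ≈ P :=
  Setoid.trans (comp_equiv_compElt _ _) (Setoid.symm (compElt_id P))

theorem comp_assoc (P : Bispan X Y) (Q : Bispan Y Z) (R : Bispan Z W) :
    (P.comp Q).comp R ≈ P.comp (Q.comp R) :=
  Setoid.trans (comp_congr (comp_equiv_compElt P Q) (Setoid.refl R)) <|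
  Setoid.trans (comp_equiv_compElt _ _) <|
  Setoid.trans (compElt_assoc P Q R) <|
  Setoid.trans (Setoid.symm (comp_equiv_compElt _ _)) <|
  comp_congr (Setoid.refl P) (Setoid.symm (comp_equiv_compElt Q R))

end Bispan

/-- The category `U_G`: its objects are the finite `G`-sets. -/
structure BispanCat (G : Type u) [Group G] where
  /-- the underlying finite `G`-set -/
  toGSet : FinGSet G

/-- Morphisms of `U_G` are equivalence classes of bispans. -/
instance BispanCat.category (G : Type u) [Group G] : Category (BispanCat G) where
  Hom X Y := Quotient (Bispan.setoid X.toGSet Y.toGSet)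
  id X := Quotient.mk _ (Bispan.id X.toGSet)
  comp := Quotient.map₂ Bispan.comp fun _ _ hP _ _ hQ => Bispan.comp_congr hP hQ
  id_comp := by
    rintro X Y ⟨Q⟩
    exact Quotient.sound (Bispan.id_comp Q)
  comp_id := by
    rintro X Y ⟨Q⟩
    exact Quotient.sound (Bispan.comp_id Q)
  assoc := by
    rintro X Y Z W ⟨P⟩ ⟨Q⟩ ⟨R⟩
    exact Quotient.sound (Bispan.comp_assoc P Q R)

/-- The property of a functor to sets of preserving finite products. -/
def additive (C : Type*) [Category C] : ObjectProperty (C ⥤ Type u) :=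
  fun T => Limits.PreservesFiniteProducts T

/-- The category `Add(C, Set)` of finite-product-preserving functors from `C` to sets, as a full
subcategory of the functor category. -/
abbrev AddFun (C : Type*) [Category C] := (additive.{u} C).FullSubcategory

/-- The functor `- ∘ F : Add(D, Set) ⥤ Add(C, Set)` for a functor `F : C ⥤ D` that preserves
finite products. -/
def AddFun.precomp {C D : Type*} [Category C] [Category D] (F : C ⥤ D)
    [Limits.PreservesFiniteProducts F] : AddFun.{u} D ⥤ AddFun.{u} C :=
  (additive.{u} C).lift ((additive.{u} D).ι ⋙ (Functor.whiskeringLeft C D (Type u)).obj F)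
    fun T => by
      have : Limits.PreservesFiniteProducts T.obj := T.property
      exact (inferInstance : Limits.PreservesFiniteProducts (F ⋙ T.obj))

/-! The pointwise left Kan extension `E` of `T` along `F` exists because `U_G` is essentially small
and the hom-sets of `U_H` are small: its value at `Y` is a colimit over the comma category of `F`
over `Y`, which is then essentially small. The functor `- ∘ F` on all functors thus has the left
adjoint `F.lan`. Since `F` preserves products, `- ∘ F` restricts to additive functors. What remains
is that `E` is additive when `T` is; then the adjunction restricts to the full subcategories, with
the same unit.

Elements of `E Y` are classes `[f, t]` with `f : F X ⟶ Y` and `t ∈ T X`. Two classes `[f₁, t₁]` and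
`[f₂, t₂]` are paired by the element `(t₁, t₂)` of `T (X₁ ⨯ X₂)` and the map `F (X₁ ⨯ X₂) ⟶ Y₁ × Y₂`
with components `F.map fst ≫ f₁` and `F.map snd ≫ f₂`. This gives surjectivity of `E (Y₁ × Y₂) → E
Y₁ × E Y₂`. For injectivity, `exists_mul_of_isPointwiseLeftKanExtension` shows that pairing with one
fixed representative is well defined on classes in the other variable; using this in each variable
in turn identifies two elements with the same projections. The pairing needs products in the source,
and in `U_G` these are disjoint unions. -/

namespace CategoryTheory.Functor

open Limits

/-! ### Binary products in functors to types, by elements -/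

variable {C D : Type*} [Category C] [Category D]

/-- A functor to types that preserves the product of `X` and `Y` has a unique element over each
pair of elements. -/
theorem exists_map_prod_eq (T : C ⥤ Type u) {X Y P : C} {p : P ⟶ X} {q : P ⟶ Y}
    [PreservesLimit (pair X Y) T] (h : IsLimit (BinaryFan.mk p q)) (x : T.obj X) (y : T.obj Y) :
    ∃ z : T.obj P, T.map p z = x ∧ T.map q z = y := by
  have hT := mapIsLimitOfPreservesOfIsLimit T p q h
  refine ⟨hT.lift (BinaryFan.mk (P := PUnit.{u + 1}) (↾fun _ => x) (↾fun _ => y)) PUnit.unit,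
    ?_, ?_⟩
  · exact ConcreteCategory.congr_hom (hT.fac (BinaryFan.mk (P := PUnit.{u + 1})
      (↾fun _ => x) (↾fun _ => y)) ⟨WalkingPair.left⟩) PUnit.unit
  · exact ConcreteCategory.congr_hom (hT.fac (BinaryFan.mk (P := PUnit.{u + 1})
      (↾fun _ => x) (↾fun _ => y)) ⟨WalkingPair.right⟩) PUnit.unit

theorem ext_of_map_prod (T : C ⥤ Type u) {X Y P : C} {p : P ⟶ X} {q : P ⟶ Y}
    [PreservesLimit (pair X Y) T] (h : IsLimit (BinaryFan.mk p q)) {z z' : T.obj P}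
    (hp : T.map p z = T.map p z') (hq : T.map q z = T.map q z') : z = z' := by
  have hT := mapIsLimitOfPreservesOfIsLimit T p q h
  have := BinaryFan.IsLimit.hom_ext hT (W := PUnit.{u + 1}) (f := ↾fun _ => z)
    (g := ↾fun _ => z') (by ext; exact hp) (by ext; exact hq)
  exact ConcreteCategory.congr_hom this PUnit.unit

/-- A functor to types preserves the product of `X` and `Y` as soon as it does so
elementwise. -/
theorem preservesLimit_pair_of_bijective (T : C ⥤ Type u) {X Y P : C} {p : P ⟶ X} {q : P ⟶ Y}
    (h : IsLimit (BinaryFan.mk p q))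
    (hT : Function.Bijective fun z : T.obj P => (T.map p z, T.map q z)) :
    PreservesLimit (pair X Y) T := by
  refine preservesLimit_of_preserves_limit_cone h ((isLimitMapConeBinaryFanEquiv T p q).symm ?_)
  refine (Types.binaryProductLimit _ _).ofIsoLimit
    (BinaryFan.ext (Equiv.ofBijective _ hT).toIso rfl rfl).symm

/-! ### Pointwise left Kan extensions of product-preserving functors -/

section LeftKan

variable {F : C ⥤ D} {T : C ⥤ Type u} {E : D ⥤ Type u} {α : T ⟶ F ⋙ E}

theorem naturality_elt (α : T ⟶ F ⋙ E) {X X' : C} (k : X ⟶ X') (t : T.obj X) :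
    E.map (F.map k) (α.app X t) = α.app X' (T.map k t) :=
  (ConcreteCategory.congr_hom (α.naturality k) t).symm

theorem map_comp_elt (E : D ⥤ Type u) {X Y Z : D} (f : X ⟶ Y) (g : Y ⟶ Z) (x : E.obj X) :
    E.map (f ≫ g) x = E.map g (E.map f x) := by
  simp

variable (hE : (LeftExtension.mk E α).IsPointwiseLeftKanExtension)

include hE

/-- Every element of a pointwise left Kan extension comes from the extended functor. -/
theorem exists_rep_of_isPointwiseLeftKanExtension {Y : D} (e : E.obj Y) :
    ∃ (X : C) (f : F.obj X ⟶ Y) (t : T.obj X), E.map f (α.app X t) = e := by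
  obtain ⟨j, t, ht⟩ := Types.jointly_surjective _ (hE Y) e
  exact ⟨j.left, j.hom, t, ht⟩

/-- Functions on a pointwise left Kan extension, defined on representatives. -/
theorem exists_desc_of_isPointwiseLeftKanExtension {Y : D} {S : Type u}
    (φ : ∀ X : C, (F.obj X ⟶ Y) → T.obj X → S)
    (hφ : ∀ (X X' : C) (k : X ⟶ X') (f : F.obj X' ⟶ Y) (t : T.obj X),
      φ X' f (T.map k t) = φ X (F.map k ≫ f) t) :
    ∃ ψ : E.obj Y → S, ∀ X f t, ψ (E.map f (α.app X t)) = φ X f t := by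
  let c : Cocone (CostructuredArrow.proj F Y ⋙ T) :=
    { pt := S
      ι :=
        { app := fun j => ↾fun t => φ j.left j.hom t
          naturality := fun j j' k => by
            ext t
            have := hφ _ _ k.left j'.hom t
            rw [CostructuredArrow.w k] at this
            exact this } }
  refine ⟨(hE Y).desc c, fun X f t => ?_⟩
  exact ConcreteCategory.congr_hom ((hE Y).fac c (CostructuredArrow.mk f)) t

variable [HasFiniteProducts C] [PreservesFiniteProducts T]

/-- The partial multiplication of a pointwise left Kan extension with the class of an
element. -/
theorem exists_mul_of_isPointwiseLeftKanExtension {Y₁ Y₂ P : D} {p : P ⟶ Y₁} {q : P ⟶ Y₂}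
    (h : IsLimit (BinaryFan.mk p q)) {X₂ : C} (f₂ : F.obj X₂ ⟶ Y₂) (t₂ : T.obj X₂) :
    ∃ ψ : E.obj Y₁ → E.obj P, ∀ (X₁ X : C) (f₁ : F.obj X₁ ⟶ Y₁) (p₁ : X ⟶ X₁) (p₂ : X ⟶ X₂)
      (f : F.obj X ⟶ P) (t : T.obj X), f ≫ p = F.map p₁ ≫ f₁ → f ≫ q = F.map p₂ ≫ f₂ →
      T.map p₂ t = t₂ → ψ (E.map f₁ (α.app X₁ (T.map p₁ t))) = E.map f (α.app X t) := by
  choose z hz using fun (X₁ : C) (t₁ : T.obj X₁) =>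
    exists_map_prod_eq T (prodIsProd X₁ X₂) t₁ t₂
  let l (X₁ : C) (f₁ : F.obj X₁ ⟶ Y₁) : F.obj (X₁ ⨯ X₂) ⟶ P :=
    h.lift (BinaryFan.mk (F.map prod.fst ≫ f₁) (F.map prod.snd ≫ f₂))
  have hl₁ (X₁ : C) (f₁ : F.obj X₁ ⟶ Y₁) : l X₁ f₁ ≫ p = F.map prod.fst ≫ f₁ :=
    h.fac _ ⟨WalkingPair.left⟩
  have hl₂ (X₁ : C) (f₁ : F.obj X₁ ⟶ Y₁) : l X₁ f₁ ≫ q = F.map prod.snd ≫ f₂ :=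
    h.fac _ ⟨WalkingPair.right⟩
  -- Any span from `X` to `X₁` and `X₂`, not only the product, computes the pairing, since it
  -- factors through `X₁ ⨯ X₂`. Allowing the diagonal span is what later recovers an element from
  -- its own projections.
  have key (X₁ X : C) (f₁ : F.obj X₁ ⟶ Y₁) (p₁ : X ⟶ X₁) (p₂ : X ⟶ X₂)
      (f : F.obj X ⟶ P) (t : T.obj X) (h₁ : f ≫ p = F.map p₁ ≫ f₁)
      (h₂ : f ≫ q = F.map p₂ ≫ f₂) (ht : T.map p₂ t = t₂) :
      E.map (l X₁ f₁) (α.app _ (z X₁ (T.map p₁ t))) = E.map f (α.app X t) := by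
    have hf : f = F.map (prod.lift p₁ p₂) ≫ l X₁ f₁ := by
      apply BinaryFan.IsLimit.hom_ext h
      · change f ≫ p = (F.map (prod.lift p₁ p₂) ≫ l X₁ f₁) ≫ p
        rw [h₁, Category.assoc, hl₁, ← Category.assoc, ← F.map_comp, prod.lift_fst]
      · change f ≫ q = (F.map (prod.lift p₁ p₂) ≫ l X₁ f₁) ≫ q
        rw [h₂, Category.assoc, hl₂, ← Category.assoc, ← F.map_comp, prod.lift_snd]
    rw [hf, map_comp_elt, naturality_elt]
    congr 2
    apply ext_of_map_prod T (prodIsProd X₁ X₂)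
    · rw [(hz _ _).1, ← map_comp_elt, prod.lift_fst]
    · rw [(hz _ _).2, ← map_comp_elt, prod.lift_snd, ht]
  -- Compatibility with `k : X ⟶ X'` is `key` for the span `(fst ≫ k, snd)` out of `X ⨯ X₂`.
  obtain ⟨ψ, hψ⟩ := exists_desc_of_isPointwiseLeftKanExtension hE (Y := Y₁) (S := E.obj P)
    (fun X₁ f₁ t₁ => E.map (l X₁ f₁) (α.app _ (z X₁ t₁))) (fun X X' k f t => by
      have := key X' (X ⨯ X₂) f (prod.fst ≫ k) prod.snd (l X (F.map k ≫ f)) (z X t)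
        (by rw [hl₁, F.map_comp, Category.assoc]) (hl₂ _ _) (hz _ _).2
      rwa [map_comp_elt, (hz _ _).1] at this)
  exact ⟨ψ, fun X₁ X f₁ p₁ p₂ f t h₁ h₂ ht => (hψ _ _ _).trans (key X₁ X f₁ p₁ p₂ f t h₁ h₂ ht)⟩

/-- Pairing of representatives inverts the projections. Only pairings with one argument fixed have
to descend to the colimit, so no colimit in two variables at once is needed. -/
theorem preservesLimit_pair_of_isPointwiseLeftKanExtension {Y₁ Y₂ P : D} {p : P ⟶ Y₁}
    {q : P ⟶ Y₂} (h : IsLimit (BinaryFan.mk p q)) : PreservesLimit (pair Y₁ Y₂) E := by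
  refine preservesLimit_pair_of_bijective E h ⟨?_, ?_⟩
  · intro e e' hee
    obtain ⟨X, f, t, rfl⟩ := exists_rep_of_isPointwiseLeftKanExtension hE e
    obtain ⟨X', f', t', rfl⟩ := exists_rep_of_isPointwiseLeftKanExtension hE e'
    simp only [Prod.mk.injEq, ← map_comp_elt] at hee
    -- `φ` pairs with the second coordinate of `e` on the right, and `ψ` below pairs with the first
    -- coordinate of `e'` on the left; each uses a fixed representative.
    obtain ⟨φ, hφ⟩ := exists_mul_of_isPointwiseLeftKanExtension hE h (f ≫ q) t
    have h' : IsLimit (BinaryFan.mk q p) := BinaryFan.isLimitFlip h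
    obtain ⟨ψ, hψ⟩ := exists_mul_of_isPointwiseLeftKanExtension hE h' (f' ≫ p) t'
    obtain ⟨z, hz₁, hz₂⟩ := exists_map_prod_eq T (prodIsProd X' X) t' t
    let l : F.obj (X' ⨯ X) ⟶ P :=
      h.lift (BinaryFan.mk (F.map prod.fst ≫ f' ≫ p) (F.map prod.snd ≫ f ≫ q))
    have hl₁ : l ≫ p = F.map prod.fst ≫ f' ≫ p := h.fac _ ⟨WalkingPair.left⟩
    have hl₂ : l ≫ q = F.map prod.snd ≫ f ≫ q := h.fac _ ⟨WalkingPair.right⟩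
    -- With the diagonal span, `φ` sends the first projection of `e` back to `e`; likewise `ψ` sends
    -- the second projection of `e'` to `e'` in `e₄`. The mixed element `[l, z]`, with `z = (t',
    -- t)`, is a value of both `φ` and `ψ` and links the two.
    have e₁ := hφ X X (f ≫ p) (𝟙 X) (𝟙 X) f t (by simp) (by simp) (by simp)
    have e₂ := hφ X' _ (f' ≫ p) prod.fst prod.snd l z hl₁ hl₂ hz₂
    have e₃ := hψ X _ (f ≫ q) prod.snd prod.fst l z hl₂ hl₁ hz₁
    have e₄ := hψ X' X' (f' ≫ q) (𝟙 X') (𝟙 X') f' t' (by simp) (by simp) (by simp)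
    rw [T.map_id, types_id_apply] at e₁ e₄
    rw [hz₁] at e₂
    rw [hz₂] at e₃
    rw [← e₁, hee.1, e₂, ← e₃, hee.2, e₄]
  · rintro ⟨e₁, e₂⟩
    obtain ⟨X₁, f₁, t₁, rfl⟩ := exists_rep_of_isPointwiseLeftKanExtension hE e₁
    obtain ⟨X₂, f₂, t₂, rfl⟩ := exists_rep_of_isPointwiseLeftKanExtension hE e₂
    obtain ⟨z, rfl, rfl⟩ := exists_map_prod_eq T (prodIsProd X₁ X₂) t₁ t₂
    let c := BinaryFan.mk (F.map (prod.fst : X₁ ⨯ X₂ ⟶ X₁) ≫ f₁) (F.map prod.snd ≫ f₂)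
    have hl₁ : h.lift c ≫ p = F.map prod.fst ≫ f₁ := h.fac c ⟨WalkingPair.left⟩
    have hl₂ : h.lift c ≫ q = F.map prod.snd ≫ f₂ := h.fac c ⟨WalkingPair.right⟩
    refine ⟨E.map (h.lift c) (α.app _ z), ?_⟩
    refine Prod.ext ?_ ?_
    · change E.map p _ = _
      rw [← map_comp_elt, hl₁, map_comp_elt, naturality_elt]
    · change E.map q _ = _
      rw [← map_comp_elt, hl₂, map_comp_elt, naturality_elt]

/-- Every map `F X ⟶ ⊤_ D` factors through `F (⊤_ C)`, so each class is represented over `⊤_ C`,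
where `T` has a single element. -/
theorem preservesTerminal_of_isPointwiseLeftKanExtension [HasTerminal D] :
    PreservesLimit (Functor.empty.{0} D) E := by
  have := Types.isTerminalEquivUnique _ (IsTerminal.isTerminalObj T (⊤_ C) terminalIsTerminal)
  have hu : Nonempty (Unique (E.obj (⊤_ D))) := by
    refine ⟨⟨⟨E.map (terminal.from _) (α.app (⊤_ C) default)⟩, fun e => ?_⟩⟩
    obtain ⟨X, f, t, rfl⟩ := exists_rep_of_isPointwiseLeftKanExtension hE e
    rw [Subsingleton.elim f (F.map (terminal.from X) ≫ terminal.from _), map_comp_elt,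
      naturality_elt, Subsingleton.elim (T.map (terminal.from X) t) default]
    rfl
  exact preservesLimit_of_preserves_limit_cone terminalIsTerminal
    ((isLimitMapConeEmptyConeEquiv E _).symm ((Types.isTerminalEquivUnique _).symm hu.some))

/-- A pointwise left Kan extension of a finite-product-preserving functor to types preserves
finite products. -/
theorem preservesFiniteProducts_of_isPointwiseLeftKanExtension [HasFiniteProducts D] :
    PreservesFiniteProducts E := by
  have : PreservesLimitsOfShape (Discrete WalkingPair) E :=
    ⟨fun {K} => by
      have := preservesLimit_pair_of_isPointwiseLeftKanExtension hE
        (prodIsProd (K.obj ⟨WalkingPair.left⟩) (K.obj ⟨WalkingPair.right⟩))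
      exact preservesLimit_of_iso_diagram E (diagramIsoPair K).symm⟩
  have := preservesTerminal_of_isPointwiseLeftKanExtension hE
  have := preservesLimitsOfShape_pempty_of_preservesTerminal E
  exact PreservesFiniteProducts.of_preserves_binary_and_terminal E

end LeftKan

end CategoryTheory.Functor

/-! ### Restriction and gluing of bispans over a disjoint union -/

namespace Bispan

open FinGSet

variable {G : Type u} [Group G] {X Y Z : FinGSet G}

/-- The bispan `Y ← X = X = X` of a map `i : X ⟶ Y`. -/
def restriction (i : X ⟶ Y) : Bispan Y X :=
  ⟨X, X, i, 𝟙 X, 𝟙 X⟩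

/-- The base change of a bispan `Z ← A → B → Y` along `i : X ⟶ Y`. -/
def restrict (P : Bispan Z Y) (i : X ⟶ Y) : Bispan Z X where
  A := pullback (P.v ≫ P.u) i
  B := pullback P.u i
  w := pullbackFst _ _ ≫ P.w
  v := homMk (fun p : PullbackSet (P.v ≫ P.u) i =>
    (⟨(P.v.hom p.1.1, p.1.2), p.2⟩ : PullbackSet P.u i)) fun g p =>
      Subtype.ext (Prod.ext (hom_smul P.v g (p : PullbackSet (P.v ≫ P.u) i).1.1) rfl)
  u := pullbackSnd _ _

/-- The middle map of `restriction i` is an identity, so its fibres are points and a section over a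
fibre is a single point of `P.B`: the exponential collapses to a fibre product. -/
theorem comp_restriction (P : Bispan Z Y) (i : X ⟶ Y) :
    P.comp (restriction i) ≈ P.restrict i := by
  refine Setoid.trans (comp_equiv_compElt _ _) (Setoid.symm ?_)
  let eB : PullbackSet P.u i ≃ CompB P (restriction i) :=
    { toFun := fun p =>
        { d := p.1.2
          s := fun _ _ => p.1.1
          hs := fun c h => p.2.trans (congrArg i.hom h).symm }
      invFun := fun t => ⟨(t.s t.d rfl, t.d), t.hs _ _⟩
      left_inv := fun _ => rfl
      right_inv := fun t => CompB.ext' rfl fun c h h' =>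
        show t.s t.d rfl = t.s c h' from CompB.s_congr rfl h'.symm _ _ }
  refine compElt_equiv_of (R := P.restrict i)
    (show PullbackSet (P.v ≫ P.u) i ≃ CompA P (restriction i) from
    { toFun := fun p =>
        { a := p.1.1
          c := p.1.2
          t := eB ⟨(P.v.hom p.1.1, p.1.2), p.2⟩
          hc := rfl
          ha := rfl }
      invFun := fun z => ⟨(z.a, z.c), (congrArg P.u.hom z.ha).trans (z.t.hs _ _)⟩
      left_inv := fun _ => rfl
      right_inv := fun z => CompA.ext' rfl rfl (CompB.ext' z.hc fun c h h' =>
        z.ha.trans (CompB.s_congr rfl (z.hc.trans h'.symm) _ _)) }) eB ?_ ?_ ?_ ?_ ?_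
  · exact fun g p => CompA.ext' rfl rfl (CompB.ext' rfl fun _ _ _ => hom_smul P.v g _)
  · exact fun g p => CompB.ext' rfl fun _ _ _ => rfl
  · exact fun _ => rfl
  · exact fun _ => rfl
  · exact fun _ => rfl

theorem restrict_congr {P Q : Bispan Z Y} (h : P ≈ Q) (i : X ⟶ Y) :
    P.restrict i ≈ Q.restrict i :=
  Setoid.trans (Setoid.symm (comp_restriction P i))
    (Setoid.trans (comp_congr h (Setoid.refl _)) (comp_restriction Q i))

/-- The disjoint union of two finite `G`-sets. -/
def disjointUnion (X Y : FinGSet G) : FinGSet G :=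
  of G (X.V ⊕ Y.V)

/-- The first inclusion in a disjoint union. -/
def inl (X Y : FinGSet G) : X ⟶ disjointUnion X Y :=
  homMk (Sum.inl : X.V → X.V ⊕ Y.V) fun _ _ => rfl

/-- The second inclusion in a disjoint union. -/
def inr (X Y : FinGSet G) : Y ⟶ disjointUnion X Y :=
  homMk (Sum.inr : Y.V → X.V ⊕ Y.V) fun _ _ => rfl

/-- The bispan `Z ← A ⊔ A' → B ⊔ B' → X ⊔ Y` obtained from `Z ← A → B → X` and
`Z ← A' → B' → Y`. -/
def glue (P : Bispan Z X) (Q : Bispan Z Y) : Bispan Z (disjointUnion X Y) where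
  A := disjointUnion P.A Q.A
  B := disjointUnion P.B Q.B
  w := homMk (Sum.elim P.w.hom Q.w.hom : P.A.V ⊕ Q.A.V → Z.V) fun g x => by
    rcases x with x | x
    · exact hom_smul P.w g x
    · exact hom_smul Q.w g x
  v := homMk (Sum.map P.v.hom Q.v.hom : P.A.V ⊕ Q.A.V → P.B.V ⊕ Q.B.V) fun g x => by
    rcases x with x | x
    · exact congrArg Sum.inl (hom_smul P.v g x)
    · exact congrArg Sum.inr (hom_smul Q.v g x)
  u := homMk (Sum.map P.u.hom Q.u.hom : P.B.V ⊕ Q.B.V → X.V ⊕ Y.V) fun g x => by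
    rcases x with x | x
    · exact congrArg Sum.inl (hom_smul P.u g x)
    · exact congrArg Sum.inr (hom_smul Q.u g x)

theorem glue_congr {P P' : Bispan Z X} {Q Q' : Bispan Z Y} (hP : P ≈ P') (hQ : Q ≈ Q') :
    glue P Q ≈ glue P' Q' := by
  obtain ⟨a, b, ha, hb, hu, hv, hw⟩ := bij_of_equiv hP
  obtain ⟨a', b', ha', hb', hu', hv', hw'⟩ := bij_of_equiv hQ
  refine equiv_of_bij (P := glue P Q) (Q := glue P' Q')
    (Equiv.sumCongr a a') (Equiv.sumCongr b b') ?_ ?_ ?_ ?_ ?_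
  · rintro g (x | x)
    · exact congrArg Sum.inl (ha g x)
    · exact congrArg Sum.inr (ha' g x)
  · rintro g (x | x)
    · exact congrArg Sum.inl (hb g x)
    · exact congrArg Sum.inr (hb' g x)
  · rintro (x | x)
    · exact congrArg Sum.inl (hu x)
    · exact congrArg Sum.inr (hu' x)
  · rintro (x | x)
    · exact congrArg Sum.inl (hv x)
    · exact congrArg Sum.inr (hv' x)
  · rintro (x | x)
    · exact hw x
    · exact hw' x

theorem glue_restrict_inl (P : Bispan Z X) (Q : Bispan Z Y) :
    (glue P Q).restrict (inl X Y) ≈ P := by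
  refine Setoid.symm (equiv_of_bij (P := P) (Q := (glue P Q).restrict (inl X Y))
    (Equiv.ofBijective (fun a => (⟨(Sum.inl a, P.u.hom (P.v.hom a)), rfl⟩ :
      PullbackSet ((glue P Q).v ≫ (glue P Q).u) (inl X Y))) ⟨?_, ?_⟩)
    (Equiv.ofBijective (fun b => (⟨(Sum.inl b, P.u.hom b), rfl⟩ :
      PullbackSet (glue P Q).u (inl X Y))) ⟨?_, ?_⟩) ?_ ?_ ?_ ?_ ?_)
  · intro a a' h
    exact Sum.inl_injective (congrArg (fun p => p.1.1) h)
  · rintro ⟨⟨a | a, x⟩, h⟩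
    · exact ⟨a, Subtype.ext (Prod.ext rfl (Sum.inl_injective h))⟩
    · exact (Sum.inr_ne_inl h).elim
  · intro a a' h
    exact Sum.inl_injective (congrArg (fun p => p.1.1) h)
  · rintro ⟨⟨a | a, x⟩, h⟩
    · exact ⟨a, Subtype.ext (Prod.ext rfl (Sum.inl_injective h))⟩
    · exact (Sum.inr_ne_inl h).elim
  · exact fun g a => Subtype.ext (Prod.ext rfl
      ((congrArg P.u.hom (hom_smul P.v g a)).trans (hom_smul P.u g _)))
  · exact fun g b => Subtype.ext (Prod.ext rfl (hom_smul P.u g b))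
  · exact fun _ => rfl
  · exact fun _ => rfl
  · exact fun _ => rfl

theorem glue_restrict_inr (P : Bispan Z X) (Q : Bispan Z Y) :
    (glue P Q).restrict (inr X Y) ≈ Q := by
  refine Setoid.symm (equiv_of_bij (P := Q) (Q := (glue P Q).restrict (inr X Y))
    (Equiv.ofBijective (fun a => (⟨(Sum.inr a, Q.u.hom (Q.v.hom a)), rfl⟩ :
      PullbackSet ((glue P Q).v ≫ (glue P Q).u) (inr X Y))) ⟨?_, ?_⟩)
    (Equiv.ofBijective (fun b => (⟨(Sum.inr b, Q.u.hom b), rfl⟩ :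
      PullbackSet (glue P Q).u (inr X Y))) ⟨?_, ?_⟩) ?_ ?_ ?_ ?_ ?_)
  · intro a a' h
    exact Sum.inr_injective (congrArg (fun p => p.1.1) h)
  · rintro ⟨⟨a | a, x⟩, h⟩
    · exact (Sum.inl_ne_inr h).elim
    · exact ⟨a, Subtype.ext (Prod.ext rfl (Sum.inr_injective h))⟩
  · intro a a' h
    exact Sum.inr_injective (congrArg (fun p => p.1.1) h)
  · rintro ⟨⟨a | a, x⟩, h⟩
    · exact (Sum.inl_ne_inr h).elim
    · exact ⟨a, Subtype.ext (Prod.ext rfl (Sum.inr_injective h))⟩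
  · exact fun g a => Subtype.ext (Prod.ext rfl
      ((congrArg Q.u.hom (hom_smul Q.v g a)).trans (hom_smul Q.u g _)))
  · exact fun g b => Subtype.ext (Prod.ext rfl (hom_smul Q.u g b))
  · exact fun _ => rfl
  · exact fun _ => rfl
  · exact fun _ => rfl

/-- A finite `G`-set over `X ⊔ Y` is the disjoint union of its restrictions to `X` and `Y`. -/
theorem bijective_sum_pullback {S : FinGSet G} (f : S ⟶ disjointUnion X Y) :
    Function.Bijective (Sum.elim (fun p => p.1.1) (fun p => p.1.1) :
      PullbackSet f (inl X Y) ⊕ PullbackSet f (inr X Y) → S.V) := by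
  constructor
  · rintro (⟨⟨s, x⟩, h⟩ | ⟨⟨s, x⟩, h⟩) (⟨⟨s', x'⟩, h'⟩ | ⟨⟨s', x'⟩, h'⟩) hs <;>
      obtain rfl : s = s' := hs
    · obtain rfl : x = x' := Sum.inl_injective (h.symm.trans h')
      rfl
    · exact (Sum.inl_ne_inr (h.symm.trans h')).elim
    · exact (Sum.inr_ne_inl (h.symm.trans h')).elim
    · obtain rfl : x = x' := Sum.inr_injective (h.symm.trans h')
      rfl
  · intro s
    rcases h : (f.hom s : X.V ⊕ Y.V) with x | x
    · exact ⟨Sum.inl ⟨(s, x), h⟩, rfl⟩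
    · exact ⟨Sum.inr ⟨(s, x), h⟩, rfl⟩

/-- This is the uniqueness half of the universal property of `X ⊔ Y`: both middle sets lie over `X ⊔
Y` and split accordingly. -/
theorem glue_restrict (P : Bispan Z (disjointUnion X Y)) :
    glue (P.restrict (inl X Y)) (P.restrict (inr X Y)) ≈ P := by
  refine equiv_of_bij (P := glue (P.restrict (inl X Y)) (P.restrict (inr X Y))) (Q := P)
    (Equiv.ofBijective _ (bijective_sum_pullback (P.v ≫ P.u)))
    (Equiv.ofBijective _ (bijective_sum_pullback P.u)) ?_ ?_ ?_ ?_ ?_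
  · rintro g (x | x) <;> rfl
  · rintro g (x | x) <;> rfl
  · rintro (x | x)
    · exact (x : PullbackSet P.u (inl X Y)).2.symm
    · exact (x : PullbackSet P.u (inr X Y)).2.symm
  · rintro (x | x) <;> rfl
  · rintro (x | x) <;> rfl

/-- The action of a group on the empty type. -/
instance : MulAction G PEmpty.{u + 1} where
  smul _ x := x
  one_smul _ := rfl
  mul_smul _ _ _ := rfl

/-- The empty bispan. -/
def toEmpty (Z : FinGSet G) : Bispan Z (of G PEmpty.{u + 1}) where
  A := of G PEmpty.{u + 1}
  B := of G PEmpty.{u + 1}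
  w := homMk (fun x : PEmpty.{u + 1} => x.elim) fun _ x => PEmpty.elim x
  v := 𝟙 _
  u := 𝟙 _

/-- Both middle sets map to the empty set and are therefore empty. This makes the empty `G`-set
terminal. -/
theorem equiv_toEmpty (P : Bispan Z (of G PEmpty.{u + 1})) : P ≈ toEmpty Z := by
  have : IsEmpty P.B.V := ⟨fun b => PEmpty.elim (P.u.hom b)⟩
  have : IsEmpty P.A.V := ⟨fun a => isEmptyElim (P.v.hom a)⟩
  exact equiv_of_bij (P := P) (Q := toEmpty Z)
    (Equiv.equivOfIsEmpty P.A.V PEmpty.{u + 1}) (Equiv.equivOfIsEmpty P.B.V PEmpty.{u + 1})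
    (fun _ x => isEmptyElim x) (fun _ x => isEmptyElim x) (fun x => isEmptyElim x)
    (fun x => isEmptyElim x) (fun x => isEmptyElim x)

end Bispan

/-! ### Finite products in the category of bispans -/

namespace BispanCat

open Limits

variable {G : Type u} [Group G]

/-- The fan on the disjoint union whose projections are the restrictions. -/
def binaryFan (X Y : BispanCat G) : BinaryFan X Y :=
  BinaryFan.mk (P := ⟨Bispan.disjointUnion X.toGSet Y.toGSet⟩)
    (Quotient.mk _ (Bispan.restriction (Bispan.inl X.toGSet Y.toGSet)))
    (Quotient.mk _ (Bispan.restriction (Bispan.inr X.toGSet Y.toGSet)))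

/-- Disjoint unions are products in the category of bispans. -/
def binaryFanIsLimit (X Y : BispanCat G) : IsLimit (binaryFan X Y) := by
  refine BinaryFan.IsLimit.mk _
    (fun {T} => Quotient.map₂ Bispan.glue fun _ _ hP _ _ hQ => Bispan.glue_congr hP hQ) ?_ ?_ ?_
  · rintro T ⟨P⟩ ⟨Q⟩
    exact Quotient.sound (Setoid.trans (Bispan.comp_restriction _ _)
      (Bispan.glue_restrict_inl P Q))
  · rintro T ⟨P⟩ ⟨Q⟩
    exact Quotient.sound (Setoid.trans (Bispan.comp_restriction _ _)
      (Bispan.glue_restrict_inr P Q))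
  · rintro T _ _ ⟨P⟩ rfl rfl
    exact Quotient.sound (Setoid.symm (Setoid.trans
      (Bispan.glue_congr (Bispan.comp_restriction _ _) (Bispan.comp_restriction _ _))
      (Bispan.glue_restrict P)))

instance : HasBinaryProducts (BispanCat G) := by
  have (X Y : BispanCat G) : HasLimit (pair X Y) := ⟨⟨_, binaryFanIsLimit X Y⟩⟩
  exact hasBinaryProducts_of_hasLimit_pair _

instance : HasTerminal (BispanCat G) := by
  have (X : BispanCat G) : Unique (X ⟶ ⟨FinGSet.of G PEmpty.{u + 1}⟩) :=
    { default := Quotient.mk _ (Bispan.toEmpty X.toGSet)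
      uniq := by
        rintro ⟨P⟩
        exact Quotient.sound (Bispan.equiv_toEmpty P) }
  exact hasTerminal_of_unique (⟨FinGSet.of G PEmpty.{u + 1}⟩ : BispanCat G)

instance : HasFiniteProducts (BispanCat G) :=
  hasFiniteProducts_of_has_binary_and_terminal

end BispanCat

/-! ### Essential smallness and existence of Kan extensions -/

namespace FinGSet

variable (G : Type u) [Group G]

/-- The actions of `G` on the standard finite sets. -/
abbrev StdAction : Type u := Σ n : ℕ, MulAction G (ULift.{u} (Fin n))

variable {G}

/-- The finite `G`-set of an action on a standard finite set. -/
def ofStdAction (i : StdAction G) : FinGSet G :=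
  letI := i.2
  of G (ULift.{u} (Fin i.1))

theorem exists_equiv_ofStdAction (X : FinGSet G) :
    ∃ (i : StdAction G) (e : X.V ≃ (ofStdAction i).V),
      ∀ (g : G) (x : X.V), e (g • x) = g • e x := by
  obtain ⟨n, ⟨e⟩⟩ := Finite.exists_equiv_fin X.V
  let e' : X.V ≃ ULift.{u} (Fin n) := e.trans Equiv.ulift.symm
  let _ : MulAction G (ULift.{u} (Fin n)) := e'.symm.mulAction G
  refine ⟨⟨n, inferInstance⟩, e', fun g x => ?_⟩
  -- The action on the standard set is transported along `e'`, so this unfolds its definition.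
  change e' (g • x) = e' (g • e'.symm (e' x))
  rw [e'.symm_apply_apply]

theorem exists_iso_ofStdAction (X : FinGSet G) :
    ∃ i : StdAction G, Nonempty (X ≅ ofStdAction i) := by
  obtain ⟨i, e, he⟩ := exists_equiv_ofStdAction X
  exact ⟨i, ⟨isoMk e he⟩⟩

end FinGSet

namespace BispanCat

open FinGSet Limits

variable {G : Type u} [Group G]

/-- The middle objects of a bispan range over a large type, but up to equivalence they may be taken
to be standard, and these are indexed by `StdAction G` in `Type u`. -/
instance : LocallySmall.{u} (BispanCat G) where
  hom_small X Y := by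
    refine small_of_surjective
      (α := Σ (i j : StdAction G), (ofStdAction i ⟶ X.toGSet) ×
        (ofStdAction i ⟶ ofStdAction j) × (ofStdAction j ⟶ Y.toGSet))
      (f := fun t => Quotient.mk _ ⟨_, _, t.2.2.1, t.2.2.2.1, t.2.2.2.2⟩) ?_
    rintro ⟨P⟩
    obtain ⟨i, ⟨a⟩⟩ := exists_iso_ofStdAction P.A
    obtain ⟨j, ⟨b⟩⟩ := exists_iso_ofStdAction P.B
    refine ⟨⟨i, j, a.inv ≫ P.w, a.inv ≫ P.v ≫ b.hom, b.inv ≫ P.u⟩, Quotient.sound ?_⟩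
    exact ⟨a.symm, b.symm, by simp, by simp, by simp⟩

/-- Restriction is contravariant, so an isomorphism of `G`-sets gives one of bispan objects in the
opposite direction. -/
theorem restriction_comp_restriction {X Y : FinGSet G} (e : X ≅ Y) :
    (Bispan.restriction e.hom).comp (Bispan.restriction e.inv) ≈ Bispan.id Y := by
  refine Setoid.trans (Bispan.comp_restriction _ _) ?_
  have h (y : Y.V) : e.hom.hom (e.inv.hom y) = y :=
    ConcreteCategory.congr_hom (congrArg Action.Hom.hom e.inv_hom_id) y
  let f : PullbackSet (𝟙 X) e.inv ≃ Y.V :=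
    { toFun := fun p => p.1.2
      invFun := fun y => ⟨(e.inv.hom y, y), rfl⟩
      left_inv := fun p => Subtype.ext (Prod.ext p.2.symm rfl)
      right_inv := fun _ => rfl }
  refine Bispan.equiv_of_bij (P := (Bispan.restriction e.hom).restrict e.inv) (Q := Bispan.id Y)
    f f (fun _ _ => rfl) (fun _ _ => rfl) (fun _ => rfl) (fun _ => rfl) fun p => ?_
  exact (congrArg e.hom.hom (p : PullbackSet (𝟙 X) e.inv).2).trans (h _)

/-- Isomorphic finite `G`-sets are isomorphic in the category of bispans. -/
def isoOfIso {X Y : FinGSet G} (e : X ≅ Y) : (⟨Y⟩ : BispanCat G) ≅ ⟨X⟩ where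
  hom := Quotient.mk _ (Bispan.restriction e.hom)
  inv := Quotient.mk _ (Bispan.restriction e.inv)
  hom_inv_id := Quotient.sound (restriction_comp_restriction e)
  inv_hom_id := Quotient.sound (restriction_comp_restriction e.symm)

instance : EssentiallySmall.{u} (BispanCat G) := by
  refine (essentiallySmall_iff _).2 ⟨?_, inferInstance⟩
  refine small_of_surjective
    (f := fun i : StdAction G => toSkeleton (⟨ofStdAction i⟩ : BispanCat G)) ?_
  intro x
  obtain ⟨X, rfl⟩ := Quotient.exists_rep x
  obtain ⟨i, ⟨e⟩⟩ := exists_iso_ofStdAction X.toGSet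
  exact ⟨i, Quotient.sound ⟨isoOfIso e⟩⟩

/-- The comma category of `F` over `Y` is essentially small, as `U_G` is and the hom-sets of `U_H`
are small; hence the colimit exists in `Type u`. -/
instance {H : Type u} [Group H] (F : BispanCat G ⥤ BispanCat H) (T : BispanCat G ⥤ Type u) :
    F.HasPointwiseLeftKanExtension T := fun Y => by
  have := hasColimitsOfShape_of_essentiallySmall.{u} (CostructuredArrow F Y) (Type u)
  exact (inferInstance : HasColimit (CostructuredArrow.proj F Y ⋙ T))

end BispanCat

/-! ### The adjunction on additive functors -/

theorem proposition3 {G H : Type u} [Group G] [Finite G] [Group H] [Finite H]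
    (F : BispanCat G ⥤ BispanCat H) [Limits.PreservesFiniteProducts F] :
    ∃ (L : AddFun.{u} (BispanCat G) ⥤ AddFun.{u} (BispanCat H)) (adj : L ⊣ AddFun.precomp F),
      ∀ T : AddFun.{u} (BispanCat G),
        Nonempty (Functor.LeftExtension.mk (L.obj T).obj
          (adj.unit.app T).hom).IsPointwiseLeftKanExtension := by
  let L : AddFun.{u} (BispanCat G) ⥤ AddFun.{u} (BispanCat H) :=
    (additive.{u} (BispanCat H)).lift ((additive.{u} (BispanCat G)).ι ⋙ F.lan) fun T => by
      have : Limits.PreservesFiniteProducts T.obj := T.property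
      exact Functor.preservesFiniteProducts_of_isPointwiseLeftKanExtension
        (F.isPointwiseLeftKanExtensionLeftKanExtensionUnit T.obj)
  let adj : L ⊣ AddFun.precomp F :=
    -- Both functors commute with the inclusions on the nose, hence the identity isomorphisms.
    (F.lanAdjunction (Type u)).restrictFullyFaithful
      (additive.{u} (BispanCat G)).fullyFaithfulι (additive.{u} (BispanCat H)).fullyFaithfulι
      (Iso.refl _) (Iso.refl _)
  refine ⟨L, adj, fun T => ⟨?_⟩⟩
  -- The pointwise property is known for the unit of the Kan extension, so the unit of the
  -- restricted adjunction has to be identified with it.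
  have h : (adj.unit.app T).hom = F.leftKanExtensionUnit T.obj := by
    have := (F.lanAdjunction (Type u)).map_restrictFullyFaithful_unit_app
      (additive.{u} (BispanCat G)).fullyFaithfulι (additive.{u} (BispanCat H)).fullyFaithfulι
      (L := L) (R := AddFun.precomp F) (Iso.refl _) (Iso.refl _) T
    refine this.trans ?_
    ext X x
    simp
    rfl
  rw [h]
  exact F.isPointwiseLeftKanExtensionLeftKanExtensionUnit T.obj
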